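/- Let $n\ge 2$, let $\Omega\subseteq\mathbb{R}^n$ be open, let $X$ be a smooth ($C^\infty$) vector field on $\Omega$, and let $C_1,\dots,C_{n-1}\in C^\infty(\Omega,\mathbb{R})$ be first integrals of $X$ (i.e. $\langle\nabla C_i(x),X(x)\rangle=0$ for all $x\in\Omega$) such that $\nabla C_1(x),\dots,\nabla C_{n-1}(x)$ are linearly independent for Lebesgue-almost every $x\in\Omega$. Let $\nu\in C^\infty(\Omega,\mathbb{R})$, put $H:=C_{n-1}$, and let $$\{f,g\}_{\nu;C_1,\dots,C_{n-2}}:=\nu\cdot\frac{\partial(C_1,\dots,C_{n-2},f,g)}{\partial(x_1,\dots,x_n)} .$$ Assume that $(\Omega,\{\cdot,\cdot\}_{\nu;C_1,\dots,C_{n-2}},H)$ is a Hamilton–Poisson realization of $X$, i.e. $X_i=\{x_i,H\}_{\nu;C_1,\dots,C_{n-2}}$ on $\Omega$ for $i=1,\dots,n$. Let $\bar x_e\in\Omega$ be a regular equilibrium, i.e. $$\nu(\bar x_e)\ne 0,\qquad \nabla C_1(\bar x_e)\wedge\dots\wedge\nabla C_{n-2}(\bar x_e)\neq 0,\qquad \nabla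 C_1(\bar x_e)\wedge\dots\wedge\nabla C_{n-1}(\bar x_e)=0$$ (for $n=2$ the empty wedge product is $1\neq0$). Let $\lambda=(\lambda_1,\dots,\lambda_{n-2})\in\mathbb{R}^{n-2}$ be the (unique) vector such that $F_\lambda:=H+\sum_{i=1}^{n-2}\lambda_iC_i$ satisfies $\nabla F_\lambda(\bar x_e)=0$. Assume that $\bar x_e$ is non-degenerate, i.e. $A:=\operatorname{Hess}F_\lambda(\bar x_e)=\mathrm{D}(\nabla F_\lambda)(\bar x_e)$ satisfies $\det A\neq0$, and put $$\mathcal I_X(\bar x_e):=\nu(\bar x_e)^2\cdot\det A\cdot\det\Big[\big\langle A^{-1}\nabla C_i(\bar x_e),\nabla C_j(\bar x_e)\big\rangle\Big]_{1\le i,j\le n-2}$$ (for $n=2$ the last determinant is $1$). Call an equilibrium $x_0\in\Omega$ of $X$ Lyapunov stable if for every open neighbourhood $U\subseteq\Omega$ of $x_0$ there is an open neighbourhood $V\subseteq U$ of $x_0$ such that for every $x\in V$ the solution of $\dot\gamma=X(\gamma)$, $\gamma(0)=x$, exists for all $t\ge0$ and satisfies $\gamma(t)\in U$ for all $t\ge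 0$; call it unstable if it is not Lyapunov stable. Then: 1. if $\mathcal I_X(\bar x_e)<0$, then $\bar x_e$ is an unstable equilibrium of $X$; 2. if $\mathcal I_X(\bar x_e)>0$, then $\bar x_e$ is a Lyapunov stable equilibrium of $X$. -/

import Mathlib

open scoped ContDiff

noncomputable section

namespace IntegrableSystem

/-- The ambient Euclidean space `ℝⁿ`, with `n = k + 2` (so that there are `k = n - 2` Casimir
functions). -/
abbrev Space (k : ℕ) : Type := EuclideanSpace ℝ (Fin (k + 2))

/-- A completely integrable system on `Ω ⊆ ℝⁿ`: a smooth vector field `X` on `Ω` with `n - 1`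
smooth first integrals `C₁, …, C_{n-1}` on `Ω` which are functionally independent at almost every
point of `Ω`. Vector fields and functions on `Ω` are given by maps on the whole space, of which
only the values on the open set `Ω` matter. -/
structure IsCompletelyIntegrable {k : ℕ} (Ω : Set (Space k)) (X : Space k → Space k)
    (C : Fin (k + 1) → Space k → ℝ) : Prop where
  isOpen : IsOpen Ω
  smooth_field : ContDiffOn ℝ ∞ X Ω
  smooth_integral : ∀ i, ContDiffOn ℝ ∞ (C i) Ω
  first_integral : ∀ i, ∀ x ∈ Ω, inner ℝ (gradient (C i) x) (X x) = 0
  independent : ∀ᵐ x ∂(MeasureTheory.volume.restrict Ω),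
    LinearIndependent ℝ (fun i => gradient (C i) x)

/-- The Jacobian determinant `∂(f₁, …, fₙ)/∂(x₁, …, xₙ)`. -/
def jacobianDet {n : ℕ} (f : Fin n → EuclideanSpace ℝ (Fin n) → ℝ)
    (x : EuclideanSpace ℝ (Fin n)) : ℝ :=
  (Matrix.of fun i j : Fin n => fderiv ℝ (f i) x (EuclideanSpace.single j 1)).det

/-- The Poisson bracket `{f, g}_{ν; C₁, …, C_{n-2}}`, characterized by
`{f, g} dx₁ ∧ … ∧ dxₙ = ν dC₁ ∧ … ∧ dC_{n-2} ∧ df ∧ dg`, that is,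
`{f, g} = ν ∂(C₁, …, C_{n-2}, f, g)/∂(x₁, …, xₙ)`. -/
def bracket {k : ℕ} (ν : Space k → ℝ) (C : Fin k → Space k → ℝ) (f g : Space k → ℝ)
    (x : Space k) : ℝ :=
  ν x * jacobianDet
    (Fin.snoc (α := fun _ => Space k → ℝ) (Fin.snoc (α := fun _ => Space k → ℝ) C f) g) x

/-- The Casimir functions `C₁, …, C_{n-2}` among `C₁, …, C_{n-1}`. -/
def casimirs {k : ℕ} (C : Fin (k + 1) → Space k → ℝ) : Fin k → Space k → ℝ :=
  fun i => C i.castSucc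

/-- The Hamiltonian `H = C_{n-1}`. -/
def hamiltonian {k : ℕ} (C : Fin (k + 1) → Space k → ℝ) : Space k → ℝ :=
  C (Fin.last k)

/-- `(Ω, {·,·}_{ν; C₁, …, C_{n-2}}, H = C_{n-1})` is a Hamilton–Poisson realization of `X`: the
rescaling function `ν` is smooth on `Ω`, and `Xᵢ = {xᵢ, H}` on `Ω` for every `i`. -/
structure IsHamiltonPoissonRealization {k : ℕ} (Ω : Set (Space k)) (X : Space k → Space k)
    (ν : Space k → ℝ) (C : Fin (k + 1) → Space k → ℝ) : Prop where
  smooth_rescaling : ContDiffOn ℝ ∞ ν Ω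
  field_eq : ∀ x ∈ Ω, ∀ i : Fin (k + 2),
    X x i = bracket ν (casimirs C) (fun y => y i) (hamiltonian C) x

/-- The set of regular equilibria: `x ∈ Ω` with `ν x ≠ 0`, `∇C₁ ∧ … ∧ ∇C_{n-2} ≠ 0` and
`∇C₁ ∧ … ∧ ∇C_{n-1} = 0` at `x`. -/
def regularEquilibria {k : ℕ} (Ω : Set (Space k)) (ν : Space k → ℝ)
    (C : Fin (k + 1) → Space k → ℝ) : Set (Space k) :=
  {x | x ∈ Ω ∧ ν x ≠ 0 ∧
    ExteriorAlgebra.ιMulti ℝ k (fun i => gradient (casimirs C i) x) ≠ 0 ∧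
    ExteriorAlgebra.ιMulti ℝ (k + 1) (fun i => gradient (C i) x) = 0}

/-- `F_λ = H + λ₁ C₁ + … + λ_{n-2} C_{n-2}`. -/
def lagrangeFun {k : ℕ} (C : Fin (k + 1) → Space k → ℝ) (lam : Fin k → ℝ) (x : Space k) : ℝ :=
  hamiltonian C x + ∑ i, lam i * casimirs C i x

/-- The Hessian operator `Hess F(x) v = D(∇F)(x) v`. -/
def hess {k : ℕ} (F : Space k → ℝ) (x : Space k) : Space k →L[ℝ] Space k :=
  fderiv ℝ (gradient F) x

/-- `x` is a non-degenerate critical point of `F`. -/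
def IsNondegenerateCriticalPoint {k : ℕ} (F : Space k → ℝ) (x : Space k) : Prop :=
  gradient F x = 0 ∧ LinearMap.det (hess F x : Space k →ₗ[ℝ] Space k) ≠ 0

/-- The inner product `⟨u₁ ∧ … ∧ uₘ, v₁ ∧ … ∧ vₘ⟩ₘ = det [⟨uᵢ, vⱼ⟩]` of decomposable
multivectors. -/
def wedgeInner {k m : ℕ} (u v : Fin m → Space k) : ℝ :=
  (Matrix.of fun i j : Fin m => inner ℝ (u i) (v j)).det

/-- The scalar `I_X(x) = ν(x)² · det (Hess F_λ(x)) ·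
⟨Hess F_λ(x)⁻¹ ∇C₁(x) ∧ … ∧ Hess F_λ(x)⁻¹ ∇C_{n-2}(x), ∇C₁(x) ∧ … ∧ ∇C_{n-2}(x)⟩_{n-2}`. -/
def stabilityScalar {k : ℕ} (ν : Space k → ℝ) (C : Fin (k + 1) → Space k → ℝ)
    (lam : Fin k → ℝ) (x : Space k) : ℝ :=
  ν x ^ 2 * LinearMap.det (hess (lagrangeFun C lam) x : Space k →ₗ[ℝ] Space k) *
    wedgeInner
      (fun i => (hess (lagrangeFun C lam) x).inverse (gradient (casimirs C i) x))
      (fun i => gradient (casimirs C i) x)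

/-- Every forward orbit starting close enough to `x₀` is defined for all `t ≥ 0` and stays in the
prescribed neighbourhood `U`. As `U ⊆ Ω` and the vector fields considered are smooth on the open
set `Ω`, the curve `γ` is the unique solution starting at `x`, i.e. `γ t = F_t(x)` for the flow
`F_t` of `X` on `Ω`. -/
def NearbyOrbitsStayNear {k : ℕ} (Ω : Set (Space k)) (X : Space k → Space k)
    (x₀ : Space k) : Prop :=
  ∀ U : Set (Space k), IsOpen U → x₀ ∈ U → U ⊆ Ω →
    ∃ V : Set (Space k), IsOpen V ∧ x₀ ∈ V ∧ V ⊆ U ∧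
      ∀ x ∈ V, ∃ γ : ℝ → Space k, γ 0 = x ∧
        IsIntegralCurveOn γ (fun _ => X) (Set.Ici 0) ∧ ∀ t : ℝ, 0 ≤ t → γ t ∈ U

/-- `x₀` is a Lyapunov stable equilibrium of the vector field `X` on `Ω`. -/
def IsLyapunovStable {k : ℕ} (Ω : Set (Space k)) (X : Space k → Space k)
    (x₀ : Space k) : Prop :=
  X x₀ = 0 ∧ NearbyOrbitsStayNear Ω X x₀

/-- `x₀` is an unstable equilibrium of the vector field `X` on `Ω`: an equilibrium that is not
Lyapunov stable. -/
def IsUnstable {k : ℕ} (Ω : Set (Space k)) (X : Space k → Space k)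
    (x₀ : Space k) : Prop :=
  X x₀ = 0 ∧ ¬ NearbyOrbitsStayNear Ω X x₀

end IntegrableSystem

end

/-! Write b for the Casimir gradients and A for the Hessian of F_λ at the equilibrium. Adding
Casimirs to H does not change the bracket, so ⟨u, X⟩ = ν det(∇C₁, …, ∇C_{n-2}, u, ∇F_λ). Since ∇F_λ
vanishes at the equilibrium, differentiation hits only the last slot: the linearization L satisfies
⟨u, L v⟩ = ν det(b, u, A v). Hence L maps into the plane Π = b^⊥, and there it is a multiple of a
quarter turn composed with the compression of A to Π. Its restriction to Π has trace 0, and its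
determinant is I_X by Jacobi's complementary minor identity (`det_mul_wedgeInner_eq`), so L² = -I_X
on Π.

If I_X < 0, put μ = √(-I_X). Then L³ = μ² L on the whole space and μ is an eigenvalue. Although 0
may also be an eigenvalue, a Chetaev function built from the three spectral components gives
instability (`not_nearbyOrbitsStayNear_of_cube_eq`).

If I_X > 0, A is definite on Π, the common kernel of the dCᵢ. A Taylor argument then isolates the
equilibrium in the joint level set of F_λ and the Casimirs (`eventually_notMem_level`). The sum of
squared deviations of these first integrals is a conserved function with a strict minimum, and
Lyapunov's method applies (`nearbyOrbitsStayNear_of_conserved`). -/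

noncomputable section

open Set Metric Filter Topology
open scoped NNReal

/-! ### Global existence for bounded Lipschitz fields -/

section ODE

variable {E : Type*} [NormedAddCommGroup E] [NormedSpace ℝ E]

/-- A bounded Lipschitz vector field on a Banach space is complete. -/
theorem LipschitzWith.exists_isIntegralCurve_of_bounded [CompleteSpace E] {Y : E → E}
    {K L : ℝ≥0} (hY : LipschitzWith K Y) (hb : ∀ x, ‖Y x‖ ≤ L) (x : E) :
    ∃ γ : ℝ → E, γ 0 = x ∧ IsIntegralCurve γ (fun _ => Y) := by
  -- A speed bound L confines a solution on [-a, a] to the ball of radius L a, so Picard–Lindelöf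
  -- applies on every such interval.
  have key : ∀ a : ℝ, 0 < a → ∃ γ : ℝ → E, γ 0 = x ∧ ∀ t ∈ Ioo (-a) a,
      HasDerivAt γ (Y (γ t)) t := by
    intro a ha
    have hP : IsPicardLindelof (fun _ => Y) (tmin := -a) (tmax := a)
        ⟨0, by constructor <;> linarith⟩ x (L * ⟨a, ha.le⟩) 0 L K := by
      refine IsPicardLindelof.of_time_independent (fun y _ => hb y) hY.lipschitzOnWith ?_
      simp only [sub_zero, zero_sub, neg_neg, max_self, NNReal.coe_zero]
      exact le_rfl
    obtain ⟨γ, h0, hγ⟩ := hP.exists_eq_forall_mem_Icc_hasDerivWithinAt₀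
    exact ⟨γ, h0, fun t ht => (hγ t (Ioo_subset_Icc_self ht)).hasDerivAt (Icc_mem_nhds ht.1 ht.2)⟩
  choose! γ h0 hγ using key
  have heq : ∀ a b : ℝ, 0 < a → a ≤ b → EqOn (γ a) (γ b) (Ioo (-a) a) := by
    intro a b ha hab
    refine ODE_solution_unique_of_mem_Ioo (v := fun _ => Y) (s := fun _ => univ) (K := K) (t₀ := 0)
      (fun t _ => hY.lipschitzOnWith) ⟨by linarith, ha⟩ (fun t ht => ⟨hγ a ha t ht, trivial⟩)
      (fun t ht => ⟨hγ b (ha.trans_le hab) t ⟨by linarith [ht.1], by linarith [ht.2]⟩, trivial⟩) ?_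
    rw [h0 a ha, h0 b (ha.trans_le hab)]
  -- Gluing: by uniqueness, this curve agrees near t with the single solution on the larger interval
  -- of radius |t| + 2.
  refine ⟨fun t => γ (|t| + 1) t, h0 _ (by positivity), fun t => ?_⟩
  have hpos : 0 < |t| + 2 := by positivity
  have hloc : (fun s => γ (|s| + 1) s) =ᶠ[𝓝 t] γ (|t| + 2) := by
    have : ∀ᶠ s in 𝓝 t, |s| < |t| + 1 :=
      continuous_abs.continuousAt.eventually_lt continuousAt_const (by simp)
    filter_upwards [this] with s hs
    exact heq _ _ (by positivity) (by linarith)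
      (abs_lt.mp (lt_add_one _))
  have h := hγ (|t| + 2) hpos t (abs_lt.mp (by linarith))
  have := h.congr_of_eventuallyEq hloc
  rwa [← hloc.eq_of_nhds] at this

end ODE

/-! ### Lyapunov and Chetaev criteria -/

namespace IntegrableSystem

/-- **Lyapunov's direct method** with a first integral: if a conserved quantity has a strict local
minimum at `x₀`, then orbits starting near `x₀` stay near `x₀`. -/
theorem nearbyOrbitsStayNear_of_conserved {k : ℕ} {Ω : Set (Space k)} (hΩ : IsOpen Ω)
    {X : Space k → Space k} (hX : ContDiffOn ℝ ∞ X Ω) {x₀ : Space k}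
    {W : Space k → ℝ} (hW : DifferentiableOn ℝ W Ω)
    (hcons : ∀ x ∈ Ω, fderiv ℝ W x (X x) = 0)
    (hmin : ∀ᶠ x in 𝓝 x₀, x ≠ x₀ → W x₀ < W x) :
    NearbyOrbitsStayNear Ω X x₀ := by
  intro U hU hx₀ hUΩ
  obtain ⟨R, hR, hball⟩ : ∃ R > 0, closedBall x₀ R ⊆ U ∩ {x | x ≠ x₀ → W x₀ < W x} :=
    nhds_basis_closedBall.mem_iff.mp (inter_mem (hU.mem_nhds hx₀) hmin)
  -- Cutting X off makes it compactly supported, hence bounded, Lipschitz and complete, without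
  -- changing it on the ball of radius R / 2.
  let f : ContDiffBump x₀ := ⟨R / 2, R, by positivity, by linarith⟩
  have hsub : closedBall x₀ R ⊆ Ω := fun x hx => hUΩ (hball hx).1
  let Y : Space k → Space k := fun x => f x • X x
  have hYsmooth : ContDiff ℝ 1 Y := by
    rw [contDiff_iff_contDiffAt]
    intro x
    by_cases hx : x ∈ closedBall x₀ R
    · exact f.contDiffAt.smul
        (((hX x (hsub hx)).contDiffAt (hΩ.mem_nhds (hsub hx))).of_le (by norm_cast))
    · have hev : Y =ᶠ[𝓝 x] fun _ => 0 := by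
        filter_upwards [isClosed_closedBall.isOpen_compl.mem_nhds hx] with y hy
        have : f y = 0 := f.zero_of_le_dist (by
          simp only [mem_compl_iff, mem_closedBall, not_le] at hy
          exact hy.le)
        simp [Y, this]
      exact contDiffAt_const.congr_of_eventuallyEq hev
  have hYc : HasCompactSupport Y := f.hasCompactSupport.smul_right
  obtain ⟨K, hK⟩ := ContDiff.lipschitzWith_of_hasCompactSupport hYc hYsmooth (by norm_num)
  obtain ⟨L, hL⟩ := hYc.exists_bound_of_continuous hYsmooth.continuous
  have hYX : ∀ x ∈ closedBall x₀ (R / 2), Y x = X x := by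
    intro x hx
    simp [Y, f.one_of_mem_closedBall hx]
  have hWc : ContinuousOn W Ω := hW.continuousOn
  obtain ⟨m, hm, hmS⟩ : ∃ m > W x₀, ∀ x ∈ sphere x₀ (R / 2), m ≤ W x := by
    have hss : sphere x₀ (R / 2) ⊆ closedBall x₀ R :=
      sphere_subset_closedBall.trans (closedBall_subset_closedBall (by linarith))
    rcases (sphere x₀ (R / 2)).eq_empty_or_nonempty with he | hne
    · exact ⟨W x₀ + 1, by linarith, by simp [he]⟩
    · obtain ⟨z, hz, hzmin⟩ := (isCompact_sphere x₀ (R / 2)).exists_isMinOn hne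
        (hWc.mono (hss.trans hsub))
      refine ⟨W z, (hball (hss hz)).2 ?_, fun x hx => hzmin hx⟩
      rintro rfl
      simp at hz
      linarith
  have hx₀Ω : x₀ ∈ Ω := hUΩ hx₀
  -- Orbits start with W < m, while W ≥ m on the sphere of radius R / 2; conservation of W forbids
  -- reaching that sphere.
  refine ⟨ball x₀ (R / 2) ∩ (Ω ∩ W ⁻¹' Iio m),
    isOpen_ball.inter (hWc.isOpen_inter_preimage hΩ isOpen_Iio),
    ⟨mem_ball_self (by positivity), hx₀Ω, hm⟩,
    fun x hx => (hball (closedBall_subset_closedBall (by linarith)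
      (ball_subset_closedBall hx.1))).1, ?_⟩
  rintro x ⟨hxb, -, hxm⟩
  obtain ⟨γ, hγ0, hγ⟩ := hK.exists_isIntegralCurve_of_bounded (L := L.toNNReal)
    (fun y => (hL y).trans (Real.le_coe_toNNReal L)) x
  have hγc : Continuous γ := continuous_iff_continuousAt.mpr fun t => (hγ t).continuousAt
  have hstay : ∀ t : ℝ, 0 ≤ t → dist (γ t) x₀ < R / 2 := by
    by_contra! hcon
    obtain ⟨t₁, ht₁, hfar⟩ := hcon
    -- The least element of S is the first exit time; up to it the orbit stays where the cut-off
    -- field equals X.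
    let S : Set ℝ := Icc 0 t₁ ∩ {t | R / 2 ≤ dist (γ t) x₀}
    have hS : IsCompact S := isCompact_Icc.inter_right
      (isClosed_le continuous_const (hγc.dist continuous_const))
    obtain ⟨s, hs, hleast⟩ := hS.exists_isLeast ⟨t₁, ⟨ht₁, le_rfl⟩, hfar⟩
    have hin : ∀ t ∈ Ico 0 s, dist (γ t) x₀ < R / 2 := by
      intro t ht
      by_contra! h
      exact absurd (hleast ⟨⟨ht.1, ht.2.le.trans hs.1.2⟩, h⟩) (not_le.mpr ht.2)
    have hs0 : 0 < s := by
      rcases hs.1.1.eq_or_lt with h | h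
      · exfalso
        have h1 : R / 2 ≤ dist (γ s) x₀ := hs.2
        rw [← h, hγ0] at h1
        exact absurd hxb (by simpa using h1)
      · exact h
    have hle : dist (γ s) x₀ ≤ R / 2 := by
      have hcl : s ∈ closure (Ico 0 s) := by
        rw [closure_Ico hs0.ne]; exact ⟨hs0.le, le_rfl⟩
      exact closure_minimal (fun t ht => (hin t ht).le)
        (isClosed_le (hγc.dist continuous_const) continuous_const) hcl
    have hΩt : ∀ t ∈ Icc 0 s, dist (γ t) x₀ ≤ R / 2 := by
      intro t ht
      rcases ht.2.eq_or_lt with h | h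
      · rw [h]; exact hle
      · exact (hin t ⟨ht.1, h⟩).le
    have hmemΩ : ∀ t ∈ Icc 0 s, γ t ∈ Ω := fun t ht =>
      hsub (mem_closedBall.mpr ((hΩt t ht).trans (by linarith)))
    have hderiv : ∀ t ∈ Icc 0 s, HasDerivAt (W ∘ γ) 0 t := by
      intro t ht
      have hd := ((hW _ (hmemΩ t ht)).differentiableAt
        (hΩ.mem_nhds (hmemΩ t ht))).hasFDerivAt.comp_hasDerivAt t (hγ t)
      dsimp only at hd
      rwa [hYX _ (hΩt t ht), hcons _ (hmemΩ t ht)] at hd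
    have hconst := constant_of_has_deriv_right_zero
      (fun t ht => (hderiv t ht).continuousAt.continuousWithinAt)
      (fun t ht => (hderiv t (Ico_subset_Icc_self ht)).hasDerivWithinAt) s ⟨hs0.le, le_rfl⟩
    have h1 := hmS (γ s) (mem_sphere.mpr (le_antisymm hle hs.2))
    simp only [Function.comp_apply, hγ0] at hconst
    have h2 : W x < m := hxm
    linarith
  refine ⟨γ, hγ0, fun t ht => ?_, fun t ht => (hball (mem_closedBall.mpr
    ((hstay t ht).le.trans (by linarith)))).1⟩
  have := (hγ t).hasDerivWithinAt (s := Ici 0)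
  dsimp only at this
  rwa [hYX _ (hstay t ht).le] at this

/-- **Chetaev's instability theorem** for a linearization `L` with `L³ = μ² L`, `μ > 0`, having
`μ` as an eigenvalue. -/
theorem not_nearbyOrbitsStayNear_of_cube_eq {k : ℕ} {Ω : Set (Space k)} (hΩ : IsOpen Ω)
    {X : Space k → Space k} {x₀ : Space k} (hx₀ : x₀ ∈ Ω) (hX₀ : X x₀ = 0)
    {L : Space k →L[ℝ] Space k} (hL : HasFDerivAt X L x₀) {μ : ℝ} (hμ : 0 < μ)
    (hcube : ∀ v, L (L (L v)) = μ ^ 2 • L v) {v : Space k} (hv : L (L v) + μ • L v ≠ 0) :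
    ¬ NearbyOrbitsStayNear Ω X x₀ := by
  intro hstab
  -- Since L³ = μ² L, the operators P, Q, Z are, up to positive scalars, the spectral projections
  -- for μ, -μ and 0.
  let P : Space k →L[ℝ] Space k := L ∘L L + μ • L
  let Q : Space k →L[ℝ] Space k := L ∘L L - μ • L
  let Z : Space k →L[ℝ] Space k := μ ^ 2 • ContinuousLinearMap.id ℝ (Space k) - L ∘L L
  have hPL : ∀ y, P (L y) = μ • P y := fun y => by
    simp only [P, add_apply, ContinuousLinearMap.comp_apply,
      smul_apply, hcube, smul_add, smul_smul]
    rw [add_comm, pow_two]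
  have hQL : ∀ y, Q (L y) = -(μ • Q y) := fun y => by
    simp only [Q, sub_apply, ContinuousLinearMap.comp_apply,
      smul_apply, hcube, smul_sub, smul_smul]
    rw [neg_sub, pow_two]
  have hZL : ∀ y, Z (L y) = 0 := fun y => by
    simp [Z, hcube]
  have hQP : Q (P v) = 0 := by
    simp only [P, Q, sub_apply, add_apply,
      ContinuousLinearMap.comp_apply, smul_apply, map_add, map_smul, hcube]
    module
  have hZP : Z (P v) = 0 := by
    simp [P, hZL]
  have hPP : P (P v) = (2 * μ ^ 2) • P v := by
    have : P (P v) = μ • P (L v) + μ • P (L v) := by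
      conv_lhs => rw [show P v = L (L v) + μ • L v from rfl, map_add, map_smul, hPL]
    rw [this, hPL]
    module
  have hsum : ∀ y, (2 * μ ^ 2) • y = P y + Q y + (2 : ℝ) • Z y := fun y => by
    simp only [P, Q, Z, sub_apply, add_apply,
      ContinuousLinearMap.comp_apply, smul_apply,
      ContinuousLinearMap.id_apply]
    module
  obtain ⟨c, hc, hPc, hQc, hZc⟩ : ∃ c : ℝ, 0 < c ∧ (∀ y, ‖P y‖ ≤ c * ‖y‖) ∧
      (∀ y, ‖Q y‖ ≤ c * ‖y‖) ∧ ∀ y, ‖Z y‖ ≤ c * ‖y‖ := by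
    have hP := norm_nonneg P
    have hQ := norm_nonneg Q
    have hZ := norm_nonneg Z
    exact ⟨‖P‖ + ‖Q‖ + ‖Z‖ + 1, by positivity,
      fun y => P.le_of_opNorm_le (by linarith) y,
      fun y => Q.le_of_opNorm_le (by linarith) y, fun y => Z.le_of_opNorm_le (by linarith) y⟩
  obtain ⟨r, hr, hball⟩ : ∃ r > 0, ball x₀ r ⊆
      Ω ∩ {x | ‖X x - L (x - x₀)‖ ≤ μ ^ 3 / (12 * c) * ‖x - x₀‖} := by
    refine nhds_basis_ball.mem_iff.mp (inter_mem (hΩ.mem_nhds hx₀) ?_)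
    have h := hL.isLittleO.def (show 0 < μ ^ 3 / (12 * c) by positivity)
    simp only [hX₀, sub_zero] at h
    exact h
  -- The Chetaev function; V' y w is its derivative at y in direction w.
  let V : Space k → ℝ := fun y => ‖P y‖ ^ 2 - ‖Q y‖ ^ 2 - ‖Z y‖ ^ 2
  let V' : Space k → Space k → ℝ := fun y w =>
    2 * inner ℝ (P y) (P w) - 2 * inner ℝ (Q y) (Q w) - 2 * inner ℝ (Z y) (Z w)
  -- Where V ≥ 0, P y dominates Q y and Z y, hence also y. With the factor μ³ / (12 c), each of the
  -- three remainder terms costs at most μ/3 · ‖P y‖², half of the linear gain 2 μ ‖P y‖² in total.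
  have hgrow : ∀ x ∈ ball x₀ r, 0 ≤ V (x - x₀) → μ * V (x - x₀) ≤ V' (x - x₀) (X x) := by
    intro x hx hVx
    set y := x - x₀ with hy
    obtain ⟨g, hg⟩ : ∃ g, X x = L y + g := ⟨X x - L y, by abel⟩
    have hgle : ‖g‖ ≤ μ ^ 3 / (12 * c) * ‖y‖ := by
      have := (hball hx).2
      simp only [mem_ofPred_eq] at this
      rwa [hg, ← hy, add_sub_cancel_left] at this
    have hQu : ‖Q y‖ ≤ ‖P y‖ := by
      refine abs_le_of_sq_le_sq' ?_ (norm_nonneg _) |>.2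
      have := sq_nonneg ‖Z y‖
      simp only [V] at hVx
      linarith
    have hZu : ‖Z y‖ ≤ ‖P y‖ := by
      refine abs_le_of_sq_le_sq' ?_ (norm_nonneg _) |>.2
      have := sq_nonneg ‖Q y‖
      simp only [V] at hVx
      linarith
    have hyle : μ ^ 2 * ‖y‖ ≤ 2 * ‖P y‖ := by
      have h1 : ‖(2 * μ ^ 2) • y‖ ≤ ‖P y‖ + ‖Q y‖ + 2 * ‖Z y‖ := by
        rw [hsum]
        refine (norm_add_le _ _).trans (add_le_add (norm_add_le _ _) ?_)
        rw [norm_smul]; simp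
      rw [norm_smul, Real.norm_of_nonneg (by positivity)] at h1
      linarith
    have hcg : c * ‖g‖ ≤ μ / 6 * ‖P y‖ := by
      calc c * ‖g‖ ≤ c * (μ ^ 3 / (12 * c) * ‖y‖) := by gcongr
        _ = μ / 12 * (μ ^ 2 * ‖y‖) := by field_simp
        _ ≤ μ / 12 * (2 * ‖P y‖) := by gcongr
        _ = _ := by ring
    have hbound : ∀ a b : Space k, ‖a‖ ≤ ‖P y‖ → ‖b‖ ≤ c * ‖g‖ →
        |inner ℝ a b| ≤ μ / 6 * ‖P y‖ ^ 2 := by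
      intro a b ha hb
      calc |inner ℝ a b| ≤ ‖a‖ * ‖b‖ := abs_real_inner_le_norm a b
        _ ≤ ‖P y‖ * (μ / 6 * ‖P y‖) := by
          gcongr
          exact hb.trans hcg
        _ = _ := by ring
    have b1 := abs_le.mp (hbound (P y) (P g) le_rfl (hPc g))
    have b2 := abs_le.mp (hbound (Q y) (Q g) hQu (hQc g))
    have b3 := abs_le.mp (hbound (Z y) (Z g) hZu (hZc g))
    have hV' : V' y (X x) = 2 * (μ * ‖P y‖ ^ 2 + inner ℝ (P y) (P g)) -
        2 * (-(μ * ‖Q y‖ ^ 2) + inner ℝ (Q y) (Q g)) - 2 * inner ℝ (Z y) (Z g) := by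
      simp only [V', hg, map_add, hPL, hQL, hZL, inner_add_right, inner_neg_right,
        real_inner_smul_right, real_inner_self_eq_norm_sq, zero_add]
    rw [hV']
    have hq := mul_nonneg hμ.le (sq_nonneg ‖Q y‖)
    have hz := mul_nonneg hμ.le (sq_nonneg ‖Z y‖)
    simp only [V]
    nlinarith
  obtain ⟨O, hO, hx₀O, -, hOγ⟩ := hstab (ball x₀ r) isOpen_ball (mem_ball_self hr)
    (fun x hx => (hball hx).1)
  -- P v is an eigenvector for μ, killed by Q and Z, so V is positive at this starting point.
  obtain ⟨s, hs, hsO⟩ : ∃ s : ℝ, 0 < s ∧ x₀ + s • P v ∈ O := by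
    have hcont : ContinuousAt (fun s : ℝ => x₀ + s • P v) 0 := by fun_prop
    have hev : ∀ᶠ s : ℝ in 𝓝 0, x₀ + s • P v ∈ O :=
      hcont.eventually (hO.mem_nhds (by simpa using hx₀O))
    have hev' : ∀ᶠ s : ℝ in 𝓝[>] 0, 0 < s ∧ x₀ + s • P v ∈ O :=
      (eventually_mem_nhdsWithin).and (hev.filter_mono nhdsWithin_le_nhds)
    exact hev'.exists
  obtain ⟨γ, hγ0, hγ, hγU⟩ := hOγ _ hsO
  let φ : ℝ → ℝ := fun t => V (γ t - x₀)
  have hφ0 : 0 < φ 0 := by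
    have hPv : P v ≠ 0 := hv
    have : φ 0 = ‖P (s • P v)‖ ^ 2 := by
      simp [φ, V, hγ0, hQP, hZP]
    rw [this, map_smul, hPP]
    have : s • (2 * μ ^ 2) • P v ≠ 0 :=
      smul_ne_zero hs.ne' (smul_ne_zero (by positivity) hPv)
    positivity
  have hφ' : ∀ t, 0 ≤ t →
      HasDerivWithinAt φ (V' (γ t - x₀) (X (γ t))) (Ici 0) t := by
    intro t ht
    have h := (hγ t ht).sub_const x₀
    exact (((P.hasFDerivAt.comp_hasDerivWithinAt t h).norm_sq).sub
      ((Q.hasFDerivAt.comp_hasDerivWithinAt t h).norm_sq)).sub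
      ((Z.hasFDerivAt.comp_hasDerivWithinAt t h).norm_sq)
  -- Linear growth already contradicts boundedness of V on the ball. Halving the slope supplies the
  -- strict inequality that the comparison principle needs.
  have hlow : ∀ t, 0 ≤ t → φ 0 + μ * φ 0 / 2 * t ≤ φ t := by
    intro t ht
    have hle := image_le_of_deriv_right_lt_deriv_boundary (a := 0) (b := t)
      (f := fun t => -φ t) (f' := fun t => -V' (γ t - x₀) (X (γ t)))
      (B := fun t => -(φ 0 + μ * φ 0 / 2 * t)) (B' := fun _ => -(μ * φ 0 / 2))
      (fun τ hτ => ((hφ' τ hτ.1).continuousWithinAt.mono Icc_subset_Ici_self).neg)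
      (fun τ hτ => ((hφ' τ hτ.1).mono (Ici_subset_Ici.mpr hτ.1)).neg) (by simp)
      (fun τ => by
        have h := (((hasDerivAt_id τ).const_mul (μ * φ 0 / 2)).const_add (φ 0)).neg
        rw [mul_one] at h
        exact h)
      (fun τ hτ heq => by
        have hpos : 0 < μ * φ 0 := mul_pos hμ hφ0
        have hτ0 : 0 ≤ μ * φ 0 / 2 * τ := mul_nonneg (by linarith) hτ.1
        have heq' : φ τ = φ 0 + μ * φ 0 / 2 * τ := neg_injective heq
        have hge : φ 0 ≤ φ τ := by linarith
        have h1 := hgrow (γ τ) (hγU τ hτ.1) (hφ0.le.trans hge)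
        have h2 : μ * φ 0 ≤ μ * V (γ τ - x₀) := mul_le_mul_of_nonneg_left hge hμ.le
        linarith)
      (right_mem_Icc.mpr ht)
    linarith
  have hup : ∀ t, 0 ≤ t → φ t ≤ (c * r) ^ 2 := by
    intro t ht
    have h1 : ‖P (γ t - x₀)‖ ≤ c * r := (hPc _).trans
      (mul_le_mul_of_nonneg_left (mem_ball_iff_norm.mp (hγU t ht)).le hc.le)
    have h2 : ‖P (γ t - x₀)‖ ^ 2 ≤ (c * r) ^ 2 := by gcongr
    simp only [φ, V]
    nlinarith [sq_nonneg ‖Q (γ t - x₀)‖, sq_nonneg ‖Z (γ t - x₀)‖]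
  have hpos : 0 < μ * φ 0 / 2 := by positivity
  have hT : 0 ≤ (c * r) ^ 2 / (μ * φ 0 / 2) := by positivity
  have h1 := hlow _ hT
  have h2 := hup _ hT
  rw [mul_div_cancel₀ _ hpos.ne'] at h1
  linarith

/-! ### Determinants of k vectors completed by a pair -/

variable {k : ℕ}

/-- The family `b₁, …, bₖ, u, w`. -/
def appendPair (b : Fin k → Space k) (u w : Space k) : Fin (k + 2) → Space k :=
  Fin.snoc (α := fun _ => Space k) (Fin.snoc (α := fun _ => Space k) b u) w

/-- The determinant of `b₁, …, bₖ, u, w` in the standard basis. -/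
def appendDet (b : Fin k → Space k) (u w : Space k) : ℝ :=
  (EuclideanSpace.basisFun (Fin (k + 2)) ℝ).toBasis.det (appendPair b u w)

@[simp] theorem appendPair_castAdd (b : Fin k → Space k) (u w : Space k) (i : Fin k) :
    appendPair b u w (Fin.castAdd 2 i) = b i := by
  rw [appendPair, show Fin.castAdd 2 i = i.castSucc.castSucc from rfl, Fin.snoc_castSucc,
    Fin.snoc_castSucc]

@[simp] theorem appendPair_natAdd_zero (b : Fin k → Space k) (u w : Space k) :
    appendPair b u w (Fin.natAdd k 0) = u := by
  rw [appendPair, show Fin.natAdd k (0 : Fin 2) = (Fin.last k).castSucc from rfl,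
    Fin.snoc_castSucc, Fin.snoc_last]

@[simp] theorem appendPair_natAdd_one (b : Fin k → Space k) (u w : Space k) :
    appendPair b u w (Fin.natAdd k 1) = w := by
  rw [appendPair, show Fin.natAdd k (1 : Fin 2) = Fin.last (k + 1) from rfl, Fin.snoc_last]

theorem appendDet_eq_det (b : Fin k → Space k) (u w : Space k) :
    appendDet b u w = (Matrix.of fun i j => appendPair b u w i j).det := by
  rw [appendDet, Module.Basis.det_apply, ← Matrix.det_transpose]
  congr 1

theorem det_mul_det_eq_gram {n : ℕ} (v v' : Fin n → EuclideanSpace ℝ (Fin n)) :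
    (EuclideanSpace.basisFun (Fin n) ℝ).toBasis.det v *
      (EuclideanSpace.basisFun (Fin n) ℝ).toBasis.det v' =
      (Matrix.of fun i j => inner ℝ (v i) (v' j)).det := by
  rw [Module.Basis.det_apply, Module.Basis.det_apply, ← Matrix.det_transpose, ← Matrix.det_mul]
  congr 1
  ext i j
  simp [Matrix.mul_apply, Module.Basis.toMatrix_apply, PiLp.inner_apply, mul_comm]

/-- The product is a Gram determinant, and orthogonality of u, w to c makes it block upper
triangular. -/
theorem appendDet_mul_appendDet {b c : Fin k → Space k} {u w u' w' : Space k}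
    (hu : ∀ i, inner ℝ (c i) u = 0) (hw : ∀ i, inner ℝ (c i) w = 0) :
    appendDet b u w * appendDet c u' w' = wedgeInner b c *
      (inner ℝ u u' * inner ℝ w w' - inner ℝ u w' * inner ℝ w u') := by
  rw [appendDet, appendDet, det_mul_det_eq_gram, ← Matrix.det_submatrix_equiv_self
    (finSumFinEquiv : Fin k ⊕ Fin 2 ≃ Fin (k + 2))]
  have hblock : (Matrix.of fun i j => inner ℝ (appendPair b u w i) (appendPair c u' w' j)).submatrix
      (finSumFinEquiv : Fin k ⊕ Fin 2 ≃ Fin (k + 2)) finSumFinEquiv =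
      Matrix.fromBlocks (Matrix.of fun i j => inner ℝ (b i) (c j))
        (Matrix.of fun i j => inner ℝ (b i) (appendPair c u' w' (Fin.natAdd k j))) 0
        (!![inner ℝ u u', inner ℝ u w'; inner ℝ w u', inner ℝ w w'] : Matrix (Fin 2) (Fin 2) ℝ) := by
    ext i j
    rcases i with i | i <;> rcases j with j | j
    · simp
    · simp
    · fin_cases i
      · simpa [real_inner_comm] using hu j
      · simpa [real_inner_comm] using hw j
    · fin_cases i <;> fin_cases j <;> simp
  rw [hblock, Matrix.det_fromBlocks_zero₂₁, Matrix.det_fin_two_of]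
  rfl

theorem appendDet_map (A : Space k →ₗ[ℝ] Space k) (b : Fin k → Space k) (u w : Space k) :
    appendDet (fun i => A (b i)) (A u) (A w) = LinearMap.det A * appendDet b u w := by
  rw [appendDet, appendDet, ← Module.Basis.det_comp]
  congr 1
  ext1 i
  refine Fin.addCases (fun i => by simp) (fun i => ?_) i
  fin_cases i
  · exact (appendPair_natAdd_zero _ _ _).trans (congrArg A (appendPair_natAdd_zero b u w).symm)
  · exact (appendPair_natAdd_one _ _ _).trans (congrArg A (appendPair_natAdd_one b u w).symm)

theorem appendDet_add (b : Fin k → Space k) (u w w' : Space k) :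
    appendDet b u (w + w') = appendDet b u w + appendDet b u w' :=
  MultilinearMap.snoc_add
    (EuclideanSpace.basisFun (Fin (k + 2)) ℝ).toBasis.det.toMultilinearMap _ w w'

theorem appendDet_smul (b : Fin k → Space k) (u : Space k) (t : ℝ) (w : Space k) :
    appendDet b u (t • w) = t * appendDet b u w :=
  MultilinearMap.snoc_smul
    (EuclideanSpace.basisFun (Fin (k + 2)) ℝ).toBasis.det.toMultilinearMap _ t w

/-- The linear map `w ↦ det (b₁, …, bₖ, u, w)`. -/
def appendDetHom (b : Fin k → Space k) (u : Space k) : Space k →ₗ[ℝ] ℝ where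
  toFun := appendDet b u
  map_add' := appendDet_add b u
  map_smul' := appendDet_smul b u

theorem appendDet_self (b : Fin k → Space k) (u : Space k) : appendDet b u u = 0 :=
  AlternatingMap.map_eq_zero_of_eq _ _ (i := Fin.natAdd k 0) (j := Fin.natAdd k 1)
    (by simp) (by simp [Fin.ext_iff])

theorem appendDet_left_mem (b : Fin k → Space k) (i : Fin k) (w : Space k) :
    appendDet b (b i) w = 0 :=
  AlternatingMap.map_eq_zero_of_eq _ _ (i := Fin.castAdd 2 i) (j := Fin.natAdd k 0)
    (by simp) (by simp [Fin.ext_iff, i.2.ne])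

theorem appendDet_right_mem (b : Fin k → Space k) (u : Space k) (i : Fin k) :
    appendDet b u (b i) = 0 :=
  AlternatingMap.map_eq_zero_of_eq _ _ (i := Fin.castAdd 2 i) (j := Fin.natAdd k 1)
    (by simp) (by simp [Fin.ext_iff]; omega)

theorem appendDet_swap (b : Fin k → Space k) (u w : Space k) :
    appendDet b w u = -appendDet b u w := by
  rw [appendDet, appendDet, ← AlternatingMap.map_swap _ _
    (show Fin.natAdd k (0 : Fin 2) ≠ Fin.natAdd k 1 by simp [Fin.ext_iff])]
  congr 1
  ext1 i
  refine Fin.addCases (fun i => ?_) (fun i => ?_) i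
  · rw [Function.comp_apply, Equiv.swap_apply_of_ne_of_ne (by simp [Fin.ext_iff, i.2.ne])
      (by simp [Fin.ext_iff]; omega)]
    simp
  · fin_cases i <;> simp

/-- The orthogonal complement of `k` independent vectors `b` in `ℝᵏ⁺²` has an orthonormal basis
`e₁, e₂`, and `det (b, eᵢ, ·)` is a quarter turn in this plane. -/
theorem exists_orthonormal_complement {b : Fin k → Space k} (hb : LinearIndependent ℝ b) :
    ∃ e₁ e₂ : Space k, inner ℝ e₁ e₁ = (1 : ℝ) ∧ inner ℝ e₂ e₂ = (1 : ℝ) ∧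
      inner ℝ e₁ e₂ = (0 : ℝ) ∧ (∀ i, inner ℝ (b i) e₁ = 0) ∧ (∀ i, inner ℝ (b i) e₂ = 0) ∧
      (∀ y, (∀ i, inner ℝ (b i) y = 0) → y = inner ℝ e₁ y • e₁ + inner ℝ e₂ y • e₂) ∧
      (∀ z, appendDet b e₁ z = appendDet b e₁ e₂ * inner ℝ e₂ z) ∧
      (∀ z, appendDet b e₂ z = -(appendDet b e₁ e₂ * inner ℝ e₁ z)) := by
  let S : Submodule ℝ (Space k) := Submodule.span ℝ (range b)
  have hmem : ∀ y, y ∈ Sᗮ ↔ ∀ i, inner ℝ (b i) y = 0 := by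
    intro y
    rw [Submodule.mem_orthogonal]
    refine ⟨fun h i => h _ (Submodule.subset_span ⟨i, rfl⟩), fun h u hu => ?_⟩
    induction hu using Submodule.span_induction with
    | mem x hx => obtain ⟨i, rfl⟩ := hx; exact h i
    | zero => simp
    | add x y _ _ hx hy => rw [inner_add_left, hx, hy, add_zero]
    | smul t x _ hx => rw [real_inner_smul_left, hx, mul_zero]
  have hrank : Module.finrank ℝ Sᗮ = 2 := by
    have h1 := S.finrank_add_finrank_orthogonal
    have h2 : Module.finrank ℝ S = k := by
      simpa using finrank_span_eq_card hb
    rw [h2, finrank_euclideanSpace, Fintype.card_fin] at h1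
    omega
  let e : OrthonormalBasis (Fin 2) ℝ Sᗮ :=
    (stdOrthonormalBasis ℝ Sᗮ).reindex (finCongr hrank)
  have hon := orthonormal_iff_ite.mp e.orthonormal
  have h11 : inner ℝ (e 0 : Space k) (e 0 : Space k) = (1 : ℝ) :=
    (hon 0 0).trans (by simp)
  have h22 : inner ℝ (e 1 : Space k) (e 1 : Space k) = (1 : ℝ) :=
    (hon 1 1).trans (by simp)
  have h12 : inner ℝ (e 0 : Space k) (e 1 : Space k) = (0 : ℝ) :=
    (hon 0 1).trans (by simp)
  have h21 : inner ℝ (e 1 : Space k) (e 0 : Space k) = (0 : ℝ) :=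
    (hon 1 0).trans (by simp)
  have hexp : ∀ y, (∀ i, inner ℝ (b i) y = 0) →
      y = inner ℝ (e 0 : Space k) y • (e 0 : Space k) +
        inner ℝ (e 1 : Space k) y • (e 1 : Space k) := by
    intro y hy
    have h := congrArg (Subtype.val) (e.sum_repr' ⟨y, (hmem y).mpr hy⟩)
    simpa [Fin.sum_univ_two] using h.symm
  have hspan : ∀ u n, n ∈ S → appendDet b u n = 0 := by
    intro u n hn
    have : S ≤ LinearMap.ker (appendDetHom b u) := by
      refine Submodule.span_le.mpr ?_
      rintro _ ⟨i, rfl⟩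
      exact appendDet_right_mem b u i
    exact this hn
  -- Subtracting the projection onto Sᗮ leaves a vector of Sᗮᗮ = S, which the determinant does not
  -- see.
  have hdec : ∀ z, z - inner ℝ (e 0 : Space k) z • (e 0 : Space k) -
      inner ℝ (e 1 : Space k) z • (e 1 : Space k) ∈ S := by
    intro z
    refine (Submodule.orthogonal_orthogonal S).le ((Submodule.mem_orthogonal _ _).mpr ?_)
    intro y hy
    rw [hexp y ((hmem y).mp hy)]
    simp only [inner_sub_right, inner_add_left, real_inner_smul_left, real_inner_smul_right,
      h11, h12, h21, h22]
    ring
  have hdet : ∀ u z, appendDet b u z = inner ℝ (e 0 : Space k) z * appendDet b u (e 0) +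
      inner ℝ (e 1 : Space k) z * appendDet b u (e 1) := by
    intro u z
    have h := hspan u _ (hdec z)
    change appendDetHom b u _ = 0 at h
    rw [map_sub, map_sub, map_smul, map_smul] at h
    simp only [appendDetHom, LinearMap.coe_mk, AddHom.coe_mk, smul_eq_mul] at h
    linarith
  refine ⟨e 0, e 1, h11, h22, h12, (hmem _).mp (e 0).2, (hmem _).mp (e 1).2, hexp,
    fun z => ?_, fun z => ?_⟩
  · rw [hdet, appendDet_self]; ring
  · rw [hdet, appendDet_self, appendDet_swap b (e 0) (e 1)]; ring

/-- Jacobi's complementary minor identity: for `u, w` orthogonal to `b` and a right inverse `B`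
of `A`, `det A ⟨B b₁ ∧ … ∧ B bₖ, b₁ ∧ … ∧ bₖ⟩` is the determinant of the form `A` on
the plane orthogonal to `b`, up to Gram factors. -/
theorem det_mul_wedgeInner_eq {A : Space k →L[ℝ] Space k} {B : Space k → Space k}
    (hAB : ∀ x, A (B x) = x)
    {b : Fin k → Space k} (hne : wedgeInner (fun i => B (b i)) b ≠ 0) {u w : Space k}
    (hu : ∀ i, inner ℝ (b i) u = 0) (hw : ∀ i, inner ℝ (b i) w = 0) :
    LinearMap.det (A : Space k →ₗ[ℝ] Space k) * wedgeInner (fun i => B (b i)) b *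
      (inner ℝ u u * inner ℝ w w - inner ℝ u w * inner ℝ w u) ^ 2 =
    appendDet b u w ^ 2 *
      (inner ℝ u (A u) * inner ℝ w (A w) - inner ℝ u (A w) * inner ℝ w (A u)) := by
  -- Pairing det(B b, u, w) with det(b, u, w) gives the Gram factor of the pair; pairing it with
  -- det(b, A u, A w) = det A · det(B b, u, w) gives the minor of A.
  have h1 := appendDet_mul_appendDet (b := fun i => B (b i)) (u' := u) (w' := w) hu hw
  have h2 := appendDet_mul_appendDet (b := fun i => B (b i)) (u' := A u) (w' := A w) hu hw
  have h3 := appendDet_map (A : Space k →ₗ[ℝ] Space k) (fun i => B (b i)) u w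
  simp only [ContinuousLinearMap.coe_coe, hAB] at h3
  change appendDet b (A u) (A w) = _ at h3
  rw [h3] at h2
  apply mul_left_cancel₀ hne
  generalize inner ℝ u u * inner ℝ w w - inner ℝ u w * inner ℝ w u = g at *
  generalize inner ℝ u (A u) * inner ℝ w (A w) - inner ℝ u (A w) * inner ℝ w (A u) = q at *
  generalize wedgeInner (fun i => B (b i)) b = d at *
  calc d * (LinearMap.det (A : Space k →ₗ[ℝ] Space k) * d * g ^ 2)
      = LinearMap.det (A : Space k →ₗ[ℝ] Space k) * (d * g) ^ 2 := by ring
    _ = appendDet b u w ^ 2 * (appendDet (fun i => B (b i)) u w *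
        (LinearMap.det (A : Space k →ₗ[ℝ] Space k) * appendDet (fun i => B (b i)) u w)) := by
        rw [← h1]; ring
    _ = _ := by rw [h2]; ring

/-! ### Second-order analysis at a critical point -/

section Hessian

variable {F : Space k → ℝ} {x₀ : Space k}

theorem contDiffAt_gradient (hF : ContDiffAt ℝ ∞ F x₀) : ContDiffAt ℝ ∞ (gradient F) x₀ :=
  (InnerProductSpace.toDual ℝ (Space k)).symm.contDiff.contDiffAt.comp x₀
    (hF.fderiv_right (m := ∞) (by norm_num))

theorem hasFDerivAt_gradient (hF : ContDiffAt ℝ ∞ F x₀) :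
    HasFDerivAt (gradient F) (hess F x₀) x₀ :=
  ((contDiffAt_gradient hF).differentiableAt (by norm_num)).hasFDerivAt

theorem inner_hess (hF : ContDiffAt ℝ ∞ F x₀) (v w : Space k) :
    inner ℝ (hess F x₀ v) w = fderiv ℝ (fderiv ℝ F) x₀ v w := by
  have hd : DifferentiableAt ℝ (fderiv ℝ F) x₀ :=
    (hF.fderiv_right (m := ∞) (by norm_num)).differentiableAt (by norm_num)
  have h1 := (hasFDerivAt_gradient hF).inner ℝ (hasFDerivAt_const w x₀)
  have h2 := hd.hasFDerivAt.clm_apply (hasFDerivAt_const w x₀)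
  simp only [inner_gradient_left] at h1
  simpa using congrArg (fun T => T v) (h1.unique h2)

theorem inner_hess_comm (hF : ContDiffAt ℝ ∞ F x₀) (v w : Space k) :
    inner ℝ (hess F x₀ v) w = inner ℝ v (hess F x₀ w) := by
  rw [real_inner_comm _ v, inner_hess hF, inner_hess hF]
  exact (hF.isSymmSndFDerivAt (by simpa using by norm_cast)).eq v w

/-- Second order Taylor formula at a critical point. -/
theorem eventually_abs_sub_hess_le (hF : ContDiffAt ℝ ∞ F x₀) (hcrit : gradient F x₀ = 0)
    {ε : ℝ} (hε : 0 < ε) : ∀ᶠ x in 𝓝 x₀,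
      |F x - F x₀ - 1 / 2 * inner ℝ (x - x₀) (hess F x₀ (x - x₀))| ≤ ε * ‖x - x₀‖ ^ 2 := by
  set A := hess F x₀
  have h1 := (hasFDerivAt_gradient hF).isLittleO.def hε
  simp only [hcrit, sub_zero] at h1
  have h2 : ∀ᶠ x in 𝓝 x₀, DifferentiableAt ℝ F x := by
    filter_upwards [(hF.of_le (m := 1) (by norm_cast)).eventually (by simp)] with x hx
    exact hx.differentiableAt (by norm_num)
  obtain ⟨r, hr, hball⟩ := nhds_basis_ball.mem_iff.mp (h1.and h2)
  filter_upwards [ball_mem_nhds x₀ hr] with x hx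
  -- Mean value inequality for F minus its quadratic part, whose gradient is o(‖z - x₀‖); symmetry
  -- of A identifies that gradient.
  have hderiv : ∀ z ∈ closedBall x₀ ‖x - x₀‖,
      HasFDerivWithinAt (fun z => F z - 1 / 2 * inner ℝ (z - x₀) (A (z - x₀)))
        (innerSL ℝ (gradient F z - A (z - x₀))) (closedBall x₀ ‖x - x₀‖) z := by
    intro z hz
    have hzb : z ∈ ball x₀ r :=
      mem_ball_iff_norm.mpr ((mem_closedBall_iff_norm.mp hz).trans_lt (mem_ball_iff_norm.mp hx))
    have hid := (hasFDerivAt_id (𝕜 := ℝ) z).sub_const x₀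
    have hq := (hid.inner ℝ (A.hasFDerivAt.comp z hid)).const_mul (1 / 2)
    refine (((hball hzb).2.hasFDerivAt.sub hq).congr_fderiv ?_).hasFDerivWithinAt
    ext v
    have hs : inner ℝ (z - x₀) (A v) = inner ℝ v (A (z - x₀)) := by
      rw [← inner_hess_comm hF, real_inner_comm]
    have hs' : inner ℝ (A (z - x₀)) v = inner ℝ v (A (z - x₀)) := real_inner_comm _ _
    simp only [sub_apply, smul_apply, ContinuousLinearMap.comp_apply,
      ContinuousLinearMap.prod_apply, ContinuousLinearMap.id_apply, fderivInnerCLM_apply,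
      innerSL_apply_apply, inner_sub_left (gradient F z), inner_gradient_left, Function.comp_apply, id,
      smul_eq_mul, hs, hs']
    ring
  have hbound : ∀ z ∈ closedBall x₀ ‖x - x₀‖,
      ‖innerSL ℝ (gradient F z - A (z - x₀))‖ ≤ ε * ‖x - x₀‖ := by
    intro z hz
    have hzn := mem_closedBall_iff_norm.mp hz
    have hzb : z ∈ ball x₀ r := mem_ball_iff_norm.mpr (hzn.trans_lt (mem_ball_iff_norm.mp hx))
    rw [innerSL_apply_norm]
    exact (hball hzb).1.trans (by gcongr)
  have h := (convex_closedBall x₀ ‖x - x₀‖).norm_image_sub_le_of_norm_hasFDerivWithin_le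
    hderiv hbound (mem_closedBall_self (norm_nonneg _))
    (mem_closedBall_iff_norm.mpr le_rfl)
  simp only [sub_self, inner_zero_left, mul_zero, sub_zero, Real.norm_eq_abs] at h
  calc _ = |F x - 1 / 2 * inner ℝ (x - x₀) (A (x - x₀)) - F x₀| := by congr 1; ring
    _ ≤ ε * ‖x - x₀‖ * ‖x - x₀‖ := h
    _ = _ := by ring

/-- If the Hessian of `F` at a critical point is anisotropic on the common kernel of the
differentials of the functions `C i`, then the point is isolated in its joint level set. -/
theorem eventually_notMem_level (hF : ContDiffAt ℝ ∞ F x₀) (hcrit : gradient F x₀ = 0)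
    {C : Fin k → Space k → ℝ} (hC : ∀ i, DifferentiableAt ℝ (C i) x₀)
    (haniso : ∀ v, (∀ i, inner ℝ (gradient (C i) x₀) v = 0) →
      inner ℝ v (hess F x₀ v) = 0 → v = 0) :
    ∀ᶠ x in 𝓝 x₀, x ≠ x₀ → ¬(F x = F x₀ ∧ ∀ i, C i x = C i x₀) := by
  set A := hess F x₀
  -- By anisotropy G is positive on the unit sphere, with minimum G z. A nearby level-set point
  -- would give a unit v with G v ≤ 2 ε + k ε, below G z = (k + 3) ε.
  let G : Space k → ℝ := fun v =>
    |inner ℝ v (A v)| + ∑ i, |inner ℝ (gradient (C i) x₀) v|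
  have hGc : Continuous G := by fun_prop
  obtain ⟨z, hz, hzmin⟩ := (isCompact_sphere (0 : Space k) 1).exists_isMinOn
    (NormedSpace.sphere_nonempty.mpr zero_le_one) hGc.continuousOn
  have hGz : 0 < G z := by
    have h0 : 0 ≤ G z := by positivity
    refine h0.lt_of_ne' fun h => ?_
    have hsum : 0 ≤ ∑ i, |inner ℝ (gradient (C i) x₀) z| := by positivity
    have habs := abs_nonneg (inner ℝ z (A z))
    have h1 : |inner ℝ z (A z)| = 0 := by simp only [G] at h; linarith
    have h2 : ∑ i, |inner ℝ (gradient (C i) x₀) z| = 0 := by simp only [G] at h; linarith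
    rw [Finset.sum_eq_zero_iff_of_nonneg (fun i _ => abs_nonneg _)] at h2
    have := haniso z (fun i => abs_eq_zero.mp (h2 i (Finset.mem_univ i))) (abs_eq_zero.mp h1)
    simp [this] at hz
  let ε : ℝ := G z / (k + 3)
  have hε : 0 < ε := by positivity
  have hCev : ∀ᶠ x in 𝓝 x₀, ∀ i,
      |C i x - C i x₀ - inner ℝ (gradient (C i) x₀) (x - x₀)| ≤ ε * ‖x - x₀‖ := by
    rw [eventually_all]
    intro i
    simpa only [inner_gradient_left, Real.norm_eq_abs] using (hC i).hasFDerivAt.isLittleO.def hε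
  filter_upwards [hCev, eventually_abs_sub_hess_le hF hcrit hε] with x hx1 hx2 hne
  rintro ⟨hFx, hCx⟩
  have hρ : 0 < ‖x - x₀‖ := norm_pos_iff.mpr (sub_ne_zero.mpr hne)
  set ρ := ‖x - x₀‖
  let v : Space k := ρ⁻¹ • (x - x₀)
  have hv : ‖v‖ = 1 := by
    rw [norm_smul, norm_inv, norm_norm, inv_mul_cancel₀ hρ.ne']
  have hmin : G z ≤ G v := hzmin (mem_sphere_zero_iff_norm.mpr hv)
  have hA : |inner ℝ v (A v)| ≤ 2 * ε := by
    rw [hFx, sub_self, zero_sub, abs_neg, abs_mul, abs_of_pos (by norm_num : (0 : ℝ) < 1 / 2)]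
      at hx2
    simp only [v, map_smul, real_inner_smul_left, real_inner_smul_right]
    rw [← mul_assoc, abs_mul, abs_of_pos (by positivity), ← mul_inv, inv_mul_le_iff₀ (by positivity)]
    linarith
  have hCb : ∀ i, |inner ℝ (gradient (C i) x₀) v| ≤ ε := by
    intro i
    have h := hx1 i
    rw [hCx, sub_self, zero_sub, abs_neg] at h
    simp only [v, real_inner_smul_right]
    rw [abs_mul, abs_of_pos (by positivity), inv_mul_le_iff₀ hρ]
    linarith
  have hG : G v ≤ (k + 2) * ε := by
    have h := Finset.sum_le_sum (fun i (_ : i ∈ (Finset.univ : Finset (Fin k))) => hCb i)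
    simp only [Finset.sum_const, Finset.card_univ, Fintype.card_fin, nsmul_eq_mul] at h
    simp only [G]
    linarith
  have : G z = (k + 3) * ε := by
    simp only [ε]; field_simp
  linarith

end Hessian

theorem jacobianDet_eq_appendDet (C : Fin k → Space k → ℝ) (f g : Space k → ℝ) (x : Space k) :
    jacobianDet (Fin.snoc (α := fun _ => Space k → ℝ)
      (Fin.snoc (α := fun _ => Space k → ℝ) C f) g) x =
      appendDet (fun i => gradient (C i) x) (gradient f x) (gradient g x) := by
  rw [appendDet_eq_det, jacobianDet]
  have hgrad : ∀ (f : Space k → ℝ) (j : Fin (k + 2)),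
      fderiv ℝ f x (EuclideanSpace.single j 1) = gradient f x j := by
    intro f j
    rw [← inner_gradient_left, EuclideanSpace.inner_single_right]
    simp
  congr 1
  ext i j
  rw [Matrix.of_apply, Matrix.of_apply, hgrad]
  refine congrArg (fun v : Space k => v j) ?_
  refine Fin.lastCases ?_ (fun i => ?_) i
  · simp [appendPair]
  · refine Fin.lastCases ?_ (fun i => ?_) i <;> simp [appendPair]

theorem continuous_appendDet (u : Space k) :
    Continuous fun p : (Fin k → Space k) × Space k => appendDet p.1 u p.2 := by
  simp_rw [appendDet_eq_det]
  refine Continuous.matrix_det (continuous_matrix fun i j => ?_)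
  simp only [Matrix.of_apply]
  refine Fin.lastCases ?_ (fun i => ?_) i
  · simp only [appendPair, Fin.snoc_last]; fun_prop
  · refine Fin.lastCases ?_ (fun i => ?_) i <;>
      simp only [appendPair, Fin.snoc_last, Fin.snoc_castSucc] <;> fun_prop

/-! ### The vector field near a regular equilibrium -/

section System

variable {Ω : Set (Space k)} {X : Space k → Space k} {C : Fin (k + 1) → Space k → ℝ}
  {ν : Space k → ℝ}

theorem contDiffAt_lagrangeFun (hX : IsCompletelyIntegrable Ω X C) (lam : Fin k → ℝ)
    {x : Space k} (hx : x ∈ Ω) : ContDiffAt ℝ ∞ (lagrangeFun C lam) x := by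
  have h : ∀ i, ContDiffAt ℝ ∞ (C i) x := fun i =>
    (hX.smooth_integral i).contDiffAt (hX.isOpen.mem_nhds hx)
  exact (h _).add (ContDiffAt.sum fun i _ => contDiffAt_const.mul (h _))

theorem gradient_lagrangeFun (hX : IsCompletelyIntegrable Ω X C) (lam : Fin k → ℝ)
    {x : Space k} (hx : x ∈ Ω) :
    gradient (lagrangeFun C lam) x =
      gradient (hamiltonian C) x + ∑ i, lam i • gradient (casimirs C i) x := by
  have h : ∀ i, HasFDerivAt (C i) (fderiv ℝ (C i) x) x := fun i =>
    (((hX.smooth_integral i).contDiffAt (hX.isOpen.mem_nhds hx)).differentiableAt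
      (by norm_num)).hasFDerivAt
  have hF : HasFDerivAt (lagrangeFun C lam) (fderiv ℝ (C (Fin.last k)) x +
      ∑ i : Fin k, lam i • fderiv ℝ (C i.castSucc) x) x :=
    (h _).add (HasFDerivAt.fun_sum fun i _ => (h _).const_mul (lam i))
  rw [gradient, hF.fderiv, map_add, map_sum]
  simp only [map_smulₛₗ]
  rfl

theorem fderiv_lagrangeFun_field (hX : IsCompletelyIntegrable Ω X C) (lam : Fin k → ℝ)
    {x : Space k} (hx : x ∈ Ω) : fderiv ℝ (lagrangeFun C lam) x (X x) = 0 := by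
  rw [← inner_gradient_left, gradient_lagrangeFun hX lam hx, inner_add_left, sum_inner]
  simp only [real_inner_smul_left, hamiltonian, casimirs, hX.first_integral _ x hx, mul_zero,
    Finset.sum_const_zero, add_zero]

theorem inner_field (hX : IsCompletelyIntegrable Ω X C)
    (hreal : IsHamiltonPoissonRealization Ω X ν C) (lam : Fin k → ℝ) {x : Space k} (hx : x ∈ Ω)
    (u : Space k) :
    inner ℝ u (X x) = ν x * appendDet (fun i => gradient (casimirs C i) x) u
      (gradient (lagrangeFun C lam) x) := by
  set b := fun i => gradient (casimirs C i) x with hb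
  have hH : appendDet b u (gradient (lagrangeFun C lam) x) =
      appendDet b u (gradient (hamiltonian C) x) := by
    rw [gradient_lagrangeFun hX lam hx, appendDet_add]
    have : appendDetHom b u (∑ i, lam i • gradient (casimirs C i) x) = 0 := by
      rw [map_sum]
      refine Finset.sum_eq_zero fun i _ => ?_
      rw [map_smul]
      exact (congrArg (lam i • ·) (appendDet_right_mem b u i)).trans (smul_zero _)
    change _ + appendDetHom b u _ = _
    rw [this, add_zero]
  have hcoord : ∀ i, X x i = ν x * appendDet b (EuclideanSpace.single i 1)
      (gradient (hamiltonian C) x) := by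
    intro i
    rw [hreal.field_eq x hx i, bracket, jacobianDet_eq_appendDet]
    congr 2
    have h : HasFDerivAt (fun y : Space k => y i)
        (EuclideanSpace.proj i : Space k →L[ℝ] ℝ) x :=
      (EuclideanSpace.proj i : Space k →L[ℝ] ℝ).hasFDerivAt
    refine ext_inner_right ℝ fun v => ?_
    rw [inner_gradient_left, h.fderiv, EuclideanSpace.inner_single_left]
    simp
  have hu : u = ∑ i, u i • EuclideanSpace.single i (1 : ℝ) := by
    ext j
    simp [Pi.single_apply]
  -- Linearity is set up in the last slot, so u is moved there before being expanded in coordinates.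
  rw [hH, appendDet_swap b _ u]
  have hsum : appendDet b (gradient (hamiltonian C) x) u =
      ∑ i, u i * appendDet b (gradient (hamiltonian C) x) (EuclideanSpace.single i 1) := by
    change appendDetHom b _ u = _
    conv_lhs => rw [hu]
    rw [map_sum]
    simp only [map_smul, smul_eq_mul]
    rfl
  rw [hsum, PiLp.inner_apply, ← Finset.sum_neg_distrib, Finset.mul_sum]
  refine Finset.sum_congr rfl fun i _ => ?_
  rw [hcoord, appendDet_swap b (gradient (hamiltonian C) x)]
  simp
  ring

/-- The linearization of the vector field at a critical point of `F_λ`. -/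
theorem inner_fderiv_field (hX : IsCompletelyIntegrable Ω X C)
    (hreal : IsHamiltonPoissonRealization Ω X ν C) {lam : Fin k → ℝ} {x₀ : Space k} (hx₀ : x₀ ∈ Ω)
    (hcrit : gradient (lagrangeFun C lam) x₀ = 0) (hX₀ : X x₀ = 0) (u v : Space k) :
    inner ℝ u (fderiv ℝ X x₀ v) = ν x₀ * appendDet (fun i => gradient (casimirs C i) x₀) u
      (hess (lagrangeFun C lam) x₀ v) := by
  have hΩ := hX.isOpen.mem_nhds hx₀
  have hF := contDiffAt_lagrangeFun hX lam hx₀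
  let line : ℝ → Space k := fun t => x₀ + t • v
  have hline : HasDerivAt line v 0 := by
    simpa only [id, one_smul] using ((hasDerivAt_id (0 : ℝ)).smul_const v).const_add x₀
  have hline0 : line 0 = x₀ := by simp [line]
  have hXd : HasFDerivAt X (fderiv ℝ X x₀) (line 0) := by
    rw [hline0]
    exact ((hX.smooth_field.contDiffAt hΩ).differentiableAt (by norm_num)).hasFDerivAt
  have hgd : HasFDerivAt (gradient (lagrangeFun C lam)) (hess (lagrangeFun C lam) x₀)
      (line 0) := by
    rw [hline0]; exact hasFDerivAt_gradient hF
  have h1 := hasDerivAt_iff_tendsto_slope_zero.mp (hXd.comp_hasDerivAt 0 hline)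
  have h2 := hasDerivAt_iff_tendsto_slope_zero.mp (hgd.comp_hasDerivAt 0 hline)
  simp only [Function.comp_apply, zero_add, hline0, hX₀, hcrit, sub_zero] at h1 h2
  have hlt : Tendsto line (𝓝[≠] 0) (𝓝 x₀) := by
    have := hline.continuousAt.tendsto
    rw [hline0] at this
    exact this.mono_left nhdsWithin_le_nhds
  have hgC : ∀ i, Tendsto (fun t => gradient (casimirs C i) (line t)) (𝓝[≠] 0)
      (𝓝 (gradient (casimirs C i) x₀)) := fun i =>
    (contDiffAt_gradient ((hX.smooth_integral i.castSucc).contDiffAt hΩ)).continuousAt.tendsto.comp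
      hlt
  have hν : Tendsto (fun t => ν (line t)) (𝓝[≠] 0) (𝓝 (ν x₀)) :=
    (hreal.smooth_rescaling.contDiffAt hΩ).continuousAt.tendsto.comp hlt
  -- Difference quotients pass into the last slot because ∇F_λ vanishes at x₀; only continuity of ν
  -- and of the Casimir gradients is then needed.
  have hlim := hν.mul (((continuous_appendDet u).tendsto _).comp
    ((tendsto_pi_nhds.mpr hgC).prodMk_nhds h2))
  have hlim' := (tendsto_const_nhds (x := u)).inner (𝕜 := ℝ) h1
  refine tendsto_nhds_unique hlim' (hlim.congr' ?_)
  filter_upwards [hlt.eventually hΩ] with t ht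
  simp only [Function.comp_apply]
  rw [appendDet_smul, real_inner_smul_right, inner_field hX hreal lam ht]
  ring

/-- The plane spanned by an orthonormal pair `e₁, e₂` on which the stability of the equilibrium is
decided: it is the tangent plane of the joint level set of the Casimir functions. -/
theorem exists_tangent_plane {lam : Fin k → ℝ} {x₀ : Space k}
    (hx₀ : x₀ ∈ regularEquilibria Ω ν C)
    (hnd : IsNondegenerateCriticalPoint (lagrangeFun C lam) x₀)
    (hne : stabilityScalar ν C lam x₀ ≠ 0) :
    ∃ e₁ e₂ : Space k, ∃ c : ℝ, inner ℝ e₁ e₁ = (1 : ℝ) ∧ inner ℝ e₂ e₂ = (1 : ℝ) ∧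
      inner ℝ e₁ e₂ = (0 : ℝ) ∧
      (∀ i, inner ℝ (gradient (casimirs C i) x₀) e₁ = 0) ∧
      (∀ i, inner ℝ (gradient (casimirs C i) x₀) e₂ = 0) ∧
      (∀ y, (∀ i, inner ℝ (gradient (casimirs C i) x₀) y = 0) →
        y = inner ℝ e₁ y • e₁ + inner ℝ e₂ y • e₂) ∧
      (∀ z, appendDet (fun i => gradient (casimirs C i) x₀) e₁ z = c * inner ℝ e₂ z) ∧
      (∀ z, appendDet (fun i => gradient (casimirs C i) x₀) e₂ z = -(c * inner ℝ e₁ z)) ∧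
      stabilityScalar ν C lam x₀ = (ν x₀ * c) ^ 2 *
        (inner ℝ e₁ (hess (lagrangeFun C lam) x₀ e₁) * inner ℝ e₂ (hess (lagrangeFun C lam) x₀ e₂) -
        inner ℝ e₁ (hess (lagrangeFun C lam) x₀ e₂) *
          inner ℝ e₂ (hess (lagrangeFun C lam) x₀ e₁)) := by
  obtain ⟨-, -, hwedge, -⟩ := hx₀
  have hb : LinearIndependent ℝ fun i => gradient (casimirs C i) x₀ := by
    by_contra h
    exact hwedge (AlternatingMap.map_linearDependent _ _ h)
  obtain ⟨e₁, e₂, h11, h22, h12, hb1, hb2, hexp, hd1, hd2⟩ := exists_orthonormal_complement hb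
  refine ⟨e₁, e₂, _, h11, h22, h12, hb1, hb2, hexp, hd1, hd2, ?_⟩
  -- `inverse` is a genuine inverse only for invertible operators; det A ≠ 0 ensures this.
  have hAB : ∀ x, hess (lagrangeFun C lam) x₀ ((hess (lagrangeFun C lam) x₀).inverse x) = x := by
    obtain ⟨e, he⟩ : ∃ e : Space k ≃L[ℝ] Space k,
        (e : Space k →L[ℝ] Space k) = hess (lagrangeFun C lam) x₀ :=
      ⟨ContinuousLinearMap.toContinuousLinearEquivOfDetNeZero _ hnd.2, by ext; simp⟩
    intro x
    rw [← he, ContinuousLinearMap.inverse_equiv]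
    simp
  have h := det_mul_wedgeInner_eq hAB (right_ne_zero_of_mul hne) hb1 hb2
  rw [h11, h22, h12] at h
  rw [stabilityScalar, mul_assoc, mul_pow, mul_assoc, ← h]
  ring

theorem isUnstable_of_stabilityScalar_neg (hX : IsCompletelyIntegrable Ω X C)
    (hreal : IsHamiltonPoissonRealization Ω X ν C) {x₀ : Space k}
    (hx₀ : x₀ ∈ regularEquilibria Ω ν C) {lam : Fin k → ℝ}
    (hnd : IsNondegenerateCriticalPoint (lagrangeFun C lam) x₀) (hX₀ : X x₀ = 0)
    (hneg : stabilityScalar ν C lam x₀ < 0) : IsUnstable Ω X x₀ := by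
  refine ⟨hX₀, ?_⟩
  obtain ⟨e₁, e₂, c, h11, h22, h12, hb1, hb2, hexp, hd1, hd2, hscal⟩ :=
    exists_tangent_plane hx₀ hnd hneg.ne
  have h21 : inner ℝ e₂ e₁ = (0 : ℝ) := by rw [real_inner_comm, h12]
  have hsymm := inner_hess_comm (contDiffAt_lagrangeFun hX lam hx₀.1)
  have hinner := inner_fderiv_field hX hreal hx₀.1 hnd.1 hX₀
  have hd := ((hX.smooth_field.contDiffAt (hX.isOpen.mem_nhds hx₀.1)).differentiableAt
    (by norm_num)).hasFDerivAt
  set A := hess (lagrangeFun C lam) x₀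
  set L := fderiv ℝ X x₀
  set m := ν x₀ * c
  set a := inner ℝ e₁ (A e₁) with ha
  set d := inner ℝ e₂ (A e₂) with hdd
  set p := inner ℝ e₁ (A e₂) with hp
  have hp' : inner ℝ e₂ (A e₁) = p := by rw [← hsymm, real_inner_comm]
  rw [hp'] at hscal
  have hL : ∀ v, L v = (m * inner ℝ e₂ (A v)) • e₁ - (m * inner ℝ e₁ (A v)) • e₂ := by
    intro v
    have h := hexp (L v) fun i => by
      rw [hinner, appendDet_left_mem, mul_zero]
    rw [hinner, hinner, hd1, hd2] at h
    rw [h]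
    module
  have hL1 : L e₁ = (m * p) • e₁ - (m * a) • e₂ := by rw [hL, hp']
  have hL2 : L e₂ = (m * d) • e₁ - (m * p) • e₂ := hL e₂
  let μ : ℝ := √(-stabilityScalar ν C lam x₀)
  have hμ : 0 < μ := Real.sqrt_pos.mpr (by linarith)
  have hμ2 : μ ^ 2 = m ^ 2 * (p ^ 2 - a * d) := by
    rw [Real.sq_sqrt (by linarith), hscal]; ring
  have hLL1 : L (L e₁) = μ ^ 2 • e₁ := by
    rw [hL1, map_sub, map_smul, map_smul, hL1, hL2, hμ2]
    module
  have hLL2 : L (L e₂) = μ ^ 2 • e₂ := by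
    rw [hL2, map_sub, map_smul, map_smul, hL1, hL2, hμ2]
    module
  have hcube : ∀ v, L (L (L v)) = μ ^ 2 • L v := by
    intro v
    rw [hL v]
    simp only [map_sub, map_smul, hLL1, hLL2]
    module
  -- Otherwise the diagonal entries μ² ± μ m p both vanish, and their sum 2 μ² would be 0.
  obtain ⟨v, hv⟩ : ∃ v, L (L v) + μ • L v ≠ 0 := by
    by_contra! h
    have h1 := congrArg (inner ℝ e₁) (h e₁)
    have h2 := congrArg (inner ℝ e₂) (h e₂)
    rw [hLL1, hL1] at h1
    rw [hLL2, hL2] at h2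
    simp only [inner_add_right, inner_sub_right, real_inner_smul_right, h11, h12, h21, h22,
      inner_zero_right] at h1 h2
    have := pow_pos hμ 2
    linarith
  exact not_nearbyOrbitsStayNear_of_cube_eq hX.isOpen hx₀.1 hX₀ hd hμ hcube hv

theorem isLyapunovStable_of_stabilityScalar_pos (hX : IsCompletelyIntegrable Ω X C)
    {x₀ : Space k} (hx₀ : x₀ ∈ regularEquilibria Ω ν C) {lam : Fin k → ℝ}
    (hnd : IsNondegenerateCriticalPoint (lagrangeFun C lam) x₀) (hX₀ : X x₀ = 0)
    (hpos : 0 < stabilityScalar ν C lam x₀) : IsLyapunovStable Ω X x₀ := by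
  refine ⟨hX₀, ?_⟩
  obtain ⟨e₁, e₂, c, h11, h22, h12, hb1, hb2, hexp, hd1, hd2, hscal⟩ :=
    exists_tangent_plane hx₀ hnd hpos.ne'
  have hF := contDiffAt_lagrangeFun hX lam hx₀.1
  have hsymm := inner_hess_comm hF
  have hCd : ∀ x ∈ Ω, ∀ i : Fin k, DifferentiableAt ℝ (casimirs C i) x := fun x hx i =>
    ((hX.smooth_integral i.castSucc).contDiffAt (hX.isOpen.mem_nhds hx)).differentiableAt
      (by norm_num)
  have hFd : ∀ x ∈ Ω, DifferentiableAt ℝ (lagrangeFun C lam) x := fun x hx =>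
    (contDiffAt_lagrangeFun hX lam hx).differentiableAt (by norm_num)
  have haniso : ∀ v, (∀ i, inner ℝ (gradient (casimirs C i) x₀) v = 0) →
      inner ℝ v (hess (lagrangeFun C lam) x₀ v) = 0 → v = 0 := by
    intro v hv hq
    set A := hess (lagrangeFun C lam) x₀
    set a := inner ℝ e₁ (A e₁)
    set d := inner ℝ e₂ (A e₂)
    set p := inner ℝ e₁ (A e₂)
    have hp' : inner ℝ e₂ (A e₁) = p := by rw [← hsymm, real_inner_comm]
    rw [hp'] at hscal
    have hdisc : 0 < a * d - p * p := by
      rw [hscal] at hpos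
      exact pos_of_mul_pos_right hpos (sq_nonneg _)
    have hve := hexp v hv
    set s := inner ℝ e₁ v
    set t := inner ℝ e₂ v
    rw [hve] at hq
    simp only [map_add, map_smul, inner_add_left, inner_add_right, real_inner_smul_left,
      real_inner_smul_right] at hq
    rw [hp'] at hq
    have hq' : a * s ^ 2 + 2 * p * s * t + d * t ^ 2 = 0 := by linear_combination hq
    -- Completing the square: a positive discriminant a d - p² forces t = 0, and symmetrically s =
    -- 0.
    have h1 : (a * s + p * t) ^ 2 + (a * d - p * p) * t ^ 2 = 0 := by
      linear_combination a * hq'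
    have h2 : (d * t + p * s) ^ 2 + (a * d - p * p) * s ^ 2 = 0 := by
      linear_combination d * hq'
    have ht : t = 0 := by
      by_contra h
      have := mul_pos hdisc (pow_pos (abs_pos.mpr h) 2)
      rw [sq_abs] at this
      nlinarith [sq_nonneg (a * s + p * t)]
    have hs : s = 0 := by
      by_contra h
      have := mul_pos hdisc (pow_pos (abs_pos.mpr h) 2)
      rw [sq_abs] at this
      nlinarith [sq_nonneg (d * t + p * s)]
    rw [hve, hs, ht]
    simp
  let W : Space k → ℝ := fun x => (lagrangeFun C lam x - lagrangeFun C lam x₀) ^ 2 +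
    ∑ i, (casimirs C i x - casimirs C i x₀) ^ 2
  have hWd : ∀ x ∈ Ω, HasFDerivAt W
      ((2 * (lagrangeFun C lam x - lagrangeFun C lam x₀)) • fderiv ℝ (lagrangeFun C lam) x +
        ∑ i, (2 * (casimirs C i x - casimirs C i x₀)) • fderiv ℝ (casimirs C i) x) x := by
    intro x hx
    have hsq : ∀ f : Space k → ℝ, DifferentiableAt ℝ f x → HasFDerivAt
        (fun y => (f y - f x₀) ^ 2) ((2 * (f x - f x₀)) • fderiv ℝ f x) x := fun f hf => by
      simpa using (hf.hasFDerivAt.sub_const (f x₀)).pow 2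
    exact (hsq _ (hFd x hx)).add (HasFDerivAt.fun_sum fun i _ => hsq _ (hCd x hx i))
  refine nearbyOrbitsStayNear_of_conserved hX.isOpen hX.smooth_field (W := W)
    (fun x hx => (hWd x hx).differentiableAt.differentiableWithinAt) (fun x hx => ?_) ?_
  · rw [(hWd x hx).fderiv, add_apply, smul_apply, fderiv_lagrangeFun_field hX lam hx,
      smul_zero, zero_add, sum_apply]
    refine Finset.sum_eq_zero fun i _ => ?_
    rw [smul_apply, ← inner_gradient_left]
    exact (congrArg _ (hX.first_integral i.castSucc x hx)).trans (smul_zero _)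
  · filter_upwards [eventually_notMem_level hF hnd.1 (hCd x₀ hx₀.1) haniso] with x hx hne
    have hW₀ : W x₀ = 0 := by simp [W]
    have hW : 0 ≤ W x := by positivity
    rw [hW₀]
    refine hW.lt_of_ne' fun h => hx hne ?_
    have hsum : 0 ≤ ∑ i, (casimirs C i x - casimirs C i x₀) ^ 2 := by positivity
    have hsq := sq_nonneg (lagrangeFun C lam x - lagrangeFun C lam x₀)
    simp only [W] at h
    have h1 : (lagrangeFun C lam x - lagrangeFun C lam x₀) ^ 2 = 0 := by linarith
    have h2 : ∑ i, (casimirs C i x - casimirs C i x₀) ^ 2 = 0 := by linarith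
    rw [Finset.sum_eq_zero_iff_of_nonneg (fun i _ => sq_nonneg _)] at h2
    exact ⟨sub_eq_zero.mp (pow_eq_zero_iff two_ne_zero |>.mp h1), fun i =>
      sub_eq_zero.mp (pow_eq_zero_iff two_ne_zero |>.mp (h2 i (Finset.mem_univ i)))⟩

theorem field_eq_zero (hX : IsCompletelyIntegrable Ω X C)
    (hreal : IsHamiltonPoissonRealization Ω X ν C) {lam : Fin k → ℝ} {x₀ : Space k} (hx₀ : x₀ ∈ Ω)
    (hcrit : gradient (lagrangeFun C lam) x₀ = 0) : X x₀ = 0 := by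
  refine ext_inner_left ℝ fun u => ?_
  rw [inner_field hX hreal lam hx₀, hcrit, inner_zero_right]
  have : appendDetHom (fun i => gradient (casimirs C i) x₀) u 0 = 0 := map_zero _
  exact mul_eq_zero_of_right _ this

end System

end IntegrableSystem

end

theorem theorem5p7 {k : ℕ} (Ω : Set (IntegrableSystem.Space k))
    (X : IntegrableSystem.Space k → IntegrableSystem.Space k)
    (C : Fin (k + 1) → IntegrableSystem.Space k → ℝ)
    (ν : IntegrableSystem.Space k → ℝ)
    (hX : IntegrableSystem.IsCompletelyIntegrable Ω X C)
    (hreal : IntegrableSystem.IsHamiltonPoissonRealization Ω X ν C)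
    (xe : IntegrableSystem.Space k)
    (hxe : xe ∈ IntegrableSystem.regularEquilibria Ω ν C)
    (lam : Fin k → ℝ)
    (hnd : IntegrableSystem.IsNondegenerateCriticalPoint
      (IntegrableSystem.lagrangeFun C lam) xe) :
    (IntegrableSystem.stabilityScalar ν C lam xe < 0 →
      IntegrableSystem.IsUnstable Ω X xe) ∧
    (0 < IntegrableSystem.stabilityScalar ν C lam xe →
      IntegrableSystem.IsLyapunovStable Ω X xe) :=
  have hX₀ := IntegrableSystem.field_eq_zero hX hreal hxe.1 hnd.1
  ⟨IntegrableSystem.isUnstable_of_stabilityScalar_neg hX hreal hxe hnd hX₀,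
    IntegrableSystem.isLyapunovStable_of_stabilityScalar_pos hX hxe hnd hX₀⟩
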